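/- **Setting.** An online minimization problem $P$ with binary predictions has instances $I=(x,\hat x,r)$, where $r=\langle r_1,\dots,r_n\rangle$ is a sequence of requests, and $x,\hat x\in\{0,1\}^n$. The problem comes with a fixed optimal offline algorithm $\mathrm{Opt}$, which minimizes the cost over all possible answer sequences, and $x$ encodes its solution; $\hat x$ is a prediction of $x$. A (deterministic) online algorithm $\mathrm{Alg}$ for $P$ answers request $r_i$ as a function of $(r_1,\hat x_1),\dots,(r_i,\hat x_i)$ only; $\mathrm{Alg}(I)\in[0,\infty]$ and $\mathrm{Opt}(I)$ denote the costs of the solutions produced (infeasible solutions have cost $\infty$). Let $$\mu_0(I)=\sum_{i=1}^n x_i(1-\hat x_i),\qquad \mu_1(I)=\sum_{i=1}^n (1-x_i)\hat x_i .$$ For constants $\alpha,\beta,\gamma\in[0,\infty)$, an algorithm $\mathrm{Alg}$ for $P$ is $(\alpha,\beta,\gamma)$-competitive with respect to $(\mu_0,\mu_1)$ if there is a constant $\kappa$ such that for all instances $I$ of $P$ $$\mathrm{Alg}(I)\le \alpha\cdot\mathrm{Opt}(I)+\beta\cdot\mu_0(I)+\gamma\cdot\mu_1(I)+\kappa .$$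 For $t\in\mathbb Z^+$, in the problem $\mathrm{ASG}_t$ (asymmetric string guessing with unknown history and predictions) every triple $(x,\hat x,r)$ in which the requests $r_i$ are mere prompts is an instance, the answer to $r_i$ is a bit $y_i$, and the cost is $\sum_{i=1}^n\bigl(y_i+t\,x_i(1-y_i)\bigr)$; the optimal solution is $y=x$. A problem $P$ is $\mathcal C_t$-hard with respect to $(\mu_0,\mu_1)$ if, for all constants $\alpha,\beta,\gamma\in[0,\infty)$, the existence of an $(\alpha,\beta,\gamma)$-competitive algorithm for $P$ implies the existence of an $(\alpha,\beta,\gamma)$-competitive algorithm for $\mathrm{ASG}_t$ (both with respect to $(\mu_0,\mu_1)$). **Theorem.** Let $t\in\mathbb Z^+$, and let $P$ be any online minimization problem with binary predictions that is $\mathcal C_t$-hard with respect to $(\mu_0,\mu_1)$. Then, for all constants $\alpha,\beta,\gamma\in[0,\infty)$ and any algorithm for $P$ that is $(\alpha,\beta,\gamma)$-competitive with respect to $(\mu_0,\mu_1)$, 1. $\alpha+\beta\ge t$, and 2. $\alpha+(t-1)\cdot\gamma\ge t$. -/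

import Mathlib

open scoped NNReal ENNReal

universe u v u' v'

namespace OnlinePred

/-- A triple `(x, x̂, r)`: a bitstring `x` (the true bits), a bitstring `xhat` (the predicted bits)
and a sequence `r` of requests, all of the same length `n`. -/
structure Instance (R : Type u) where
  n : ℕ
  x : Fin n → Bool
  xhat : Fin n → Bool
  r : Fin n → R

/-- An error measure: a finite nonnegative function of the true bits and the predicted bits. -/
abbrev ErrorMeasure : Type :=
  (n : ℕ) → (x xhat : Fin n → Bool) → ℝ≥0

/-- The value `η(I)` of an error measure on an instance. -/
def ErrorMeasure.eval (η : ErrorMeasure) {R : Type u} (I : Instance R) : ℝ≥0 :=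
  η I.n I.x I.xhat

/-- `μ₀(I) = ∑ i, xᵢ (1 - x̂ᵢ)`, the number of wrong predictions of `0`. -/
def mu0 : ErrorMeasure := fun n x xhat =>
  ((∑ i : Fin n, (x i).toNat * (1 - (xhat i).toNat) : ℕ) : ℝ≥0)

/-- `μ₁(I) = ∑ i, (1 - xᵢ) x̂ᵢ`, the number of wrong predictions of `1`. -/
def mu1 : ErrorMeasure := fun n x xhat =>
  ((∑ i : Fin n, (1 - (x i).toNat) * (xhat i).toNat : ℕ) : ℝ≥0)

/-- An online minimization problem with binary predictions. The answers to the requests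
form a solution, whose cost is infinite if the solution is infeasible. The cost may depend on the
true bits, because these may carry information that is hidden from the algorithm.
`opt` is a fixed optimal offline algorithm, and the true bits of an instance encode its solution
(when answers are bits, typically `encode` returns the answers themselves). -/
structure Problem where
  /-- the possible requests -/
  Request : Type u
  /-- the possible answers to a request (in most problems `Bool`) -/
  Answer : Type v
  /-- the set of instances of the problem -/
  instances : Set (Instance Request)
  /-- the cost of a sequence `y` of answers -/
  cost : {n : ℕ} → (x : Fin n → Bool) → (r : Fin n → Request) → (y : Fin n → Answer) → ℝ≥0∞
  /-- the encoding of solutions as bitstrings -/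
  encode : {n : ℕ} → (r : Fin n → Request) → (y : Fin n → Answer) → Fin n → Bool
  /-- the solution of the fixed optimal offline algorithm -/
  opt : {n : ℕ} → (x : Fin n → Bool) → (r : Fin n → Request) → Fin n → Answer
  opt_optimal : ∀ I ∈ instances, ∀ y : Fin I.n → Answer,
    cost I.x I.r (opt I.x I.r) ≤ cost I.x I.r y
  encode_opt : ∀ I ∈ instances, encode I.r (opt I.x I.r) = I.x

namespace Problem

/-- The cost `Opt(I)` of the optimal solution. -/
def optCost (P : Problem.{u, v}) (I : Instance P.Request) : ℝ≥0∞ :=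
  P.cost I.x I.r (P.opt I.x I.r)

/-- A deterministic online algorithm: when a request arrives, the answer is a function of the list
of all requests and predicted bits received so far, `(r₁, x̂₁), …, (rᵢ, x̂ᵢ)`. -/
abbrev Algorithm (P : Problem.{u, v}) : Type (max u v) :=
  List (P.Request × Bool) → P.Answer

namespace Algorithm

variable {P : Problem.{u, v}}

/-- The answers `y₁, …, yₙ` of an algorithm on an instance. -/
def answers (A : P.Algorithm) (I : Instance P.Request) : Fin I.n → P.Answer := fun i =>
  A ((List.ofFn fun j : Fin I.n => (I.r j, I.xhat j)).take (i + 1))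

/-- The cost `Alg(I)` of an algorithm on an instance. -/
def algCost (A : P.Algorithm) (I : Instance P.Request) : ℝ≥0∞ :=
  P.cost I.x I.r (A.answers I)

/-- `A` is `(α, β, γ)`-competitive with respect to `(η₀, η₁)`. The additive constant may be taken
nonnegative, since it may always be increased. -/
def IsCompetitive (A : P.Algorithm) (η₀ η₁ : ErrorMeasure)
    (α β γ : Instance P.Request → ℝ≥0) : Prop :=
  ∃ κ : ℝ≥0, ∀ I ∈ P.instances,
    A.algCost I ≤ α I * P.optCost I + β I * η₀.eval I + γ I * η₁.eval I + κ

end Algorithm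

/-- `Q` is as hard as `P` with respect to `(φ₀, φ₁)` and `(η₀, η₁)`: for all constants `α, β, γ`,
if there is an `(α, β, γ)`-competitive algorithm for `Q`, then there is one for `P`. -/
def AsHardAs (Q : Problem.{u, v}) (P : Problem.{u', v'}) (φ₀ φ₁ η₀ η₁ : ErrorMeasure) : Prop :=
  ∀ α β γ : ℝ≥0,
    (∃ A : Q.Algorithm, A.IsCompetitive φ₀ φ₁ (fun _ => α) (fun _ => β) (fun _ => γ)) →
      ∃ B : P.Algorithm, B.IsCompetitive η₀ η₁ (fun _ => α) (fun _ => β) (fun _ => γ)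

end Problem

/-- The cost `∑ i, (yᵢ + t xᵢ (1 - yᵢ))` of the guesses `y` when the string is `x`. -/
def asgCost (t : ℕ) {n : ℕ} (x y : Fin n → Bool) : ℕ :=
  ∑ i, ((y i).toNat + t * (x i).toNat * (1 - (y i).toNat))

theorem asgCost_self_le (t : ℕ+) {n : ℕ} (x y : Fin n → Bool) :
    asgCost t x x ≤ asgCost t x y := by
  refine Finset.sum_le_sum fun i _ => ?_
  have ht' : 1 ≤ (t : ℕ) := t.pos
  cases x i <;> cases y i <;> simp [ht']

/-- `(1, t)`-Asymmetric String Guessing with unknown history and predictions: every request is a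
mere prompt, every triple is an instance, and the answers are the guesses of the bits of `x`. -/
abbrev asg (t : ℕ+) : Problem.{0, 0} where
  Request := Unit
  Answer := Bool
  instances := Set.univ
  cost := fun x _ y => (asgCost t x y : ℝ≥0∞)
  encode := fun _ y => y
  opt := fun x _ => x
  opt_optimal := fun I _ y => Nat.cast_le.mpr (asgCost_self_le t I.x y)
  encode_opt := fun _ _ => rfl

/-- `P` is hard for the class of the problems that are no harder than `asg t` with respect to
`(η₀, η₁)`, i.e. `P` is as hard as `asg t`. -/
def IsHard (η₀ η₁ : ErrorMeasure) (t : ℕ+) (P : Problem.{u, v}) : Prop :=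
  P.AsHardAs (asg t) η₀ η₁ η₀ η₁

end OnlinePred

/-!
Hardness turns the given algorithm into an `(α, β, γ)`-competitive algorithm for `asg t`, so it is
enough to bound the constants of such an algorithm. The prompts carry no information and the history
is unknown, so the guesses `y` depend on the predictions `x̂` alone and not on the true string `x`.
An adversary may therefore fix `x̂` to be constant, look at `y`, and only then pick `x`
(`exists_guesses_of_isCompetitive`).

Against the string `x = ¬y` every guess is wrong. If `y` has `k` ones and `m` zeros, the algorithm
pays `k + t * m` and the optimum pays `m`. With `x̂ = 0` the predictions err exactly on the `m` ones
of `x`, so `k + t * m ≤ (α + β) * m + κ`; if `α + β < t`, this bounds both `k` and `m`, although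
`k + m = n` is arbitrary. With `x̂ = 1` they err exactly on the `k` zeros of `x`, so
`k + t * m ≤ α * m + γ * k + κ`, which in the same way excludes `γ < 1` together with `α < t`.
If `γ ≥ 1`, the string `x = 1`, on which every guess costs at least `1` and no prediction errs,
forces `α ≥ 1`, whence `t ≤ α + (t - 1) * γ`.
-/

namespace OnlinePred

/-- The guesses of an online algorithm for `asg t` do not depend on the true string: for a constant
prediction `b`, the strings `y` are fixed before `x` is chosen. -/
theorem exists_guesses_of_isCompetitive {t : ℕ+} {B : (asg t).Algorithm} {α β γ : ℝ≥0}
    (hB : B.IsCompetitive mu0 mu1 (fun _ => α) (fun _ => β) (fun _ => γ)) (b : Bool) :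
    ∃ κ : ℝ, ∀ n : ℕ, ∃ y : Fin n → Bool, ∀ x : Fin n → Bool,
      (asgCost t x y : ℝ) ≤ α * asgCost t x x + β * (mu0 n x fun _ => b)
        + γ * (mu1 n x fun _ => b) + κ := by
  obtain ⟨κ, hκ⟩ := hB
  refine ⟨κ, fun n => ⟨fun i => B ((List.ofFn fun _ : Fin n => ((), b)).take (i + 1)),
    fun x => ?_⟩⟩
  have h := hκ ⟨n, x, fun _ => b, fun _ => ()⟩ (Set.mem_univ _)
  simp only [Problem.Algorithm.algCost, Problem.optCost, ErrorMeasure.eval] at h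
  exact_mod_cast h

theorem sum_toNat_add_sum_toNat_not {n : ℕ} (y : Fin n → Bool) :
    ∑ i, (y i).toNat + ∑ i, (!y i).toNat = n := by
  rw [← Finset.sum_add_distrib, Finset.sum_congr rfl (g := fun _ => 1)]
  · simp
  · intro i _
    cases y i <;> rfl

theorem asgCost_not_left (t : ℕ) {n : ℕ} (y : Fin n → Bool) :
    asgCost t (fun i => !y i) y = ∑ i, (y i).toNat + t * ∑ i, (!y i).toNat := by
  rw [asgCost, Finset.mul_sum, ← Finset.sum_add_distrib]
  refine Finset.sum_congr rfl fun i _ => ?_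
  cases y i <;> simp

theorem asgCost_self (t : ℕ) {n : ℕ} (x : Fin n → Bool) :
    asgCost t x x = ∑ i, (x i).toNat := by
  refine Finset.sum_congr rfl fun i _ => ?_
  cases x i <;> simp

theorem le_asgCost_true (t : ℕ+) {n : ℕ} (y : Fin n → Bool) :
    n ≤ asgCost t (fun _ => true) y := by
  simpa [asgCost_self] using asgCost_self_le t (fun _ => true) y

/-- A sum of two positive multiples of natural numbers adding up to `n` is unbounded as `n`
grows. -/
theorem exists_lt_mul_add_mul {a b : ℝ} (ha : 0 < a) (hb : 0 < b) (κ : ℝ) :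
    ∃ n : ℕ, ∀ k m : ℕ, k + m = n → κ < a * k + b * m := by
  have hc : 0 < min a b := lt_min ha hb
  obtain ⟨n, hn⟩ := exists_nat_gt (κ / min a b)
  refine ⟨n, fun k m hkm => ?_⟩
  rw [div_lt_iff₀ hc, ← hkm, Nat.cast_add, add_mul, mul_comm (k : ℝ), mul_comm (m : ℝ)] at hn
  refine hn.trans_le ?_
  gcongr
  · exact min_le_left a b
  · exact min_le_right a b

theorem le_add_of_isCompetitive_asg {t : ℕ+} {B : (asg t).Algorithm} {α β γ : ℝ≥0}
    (hB : B.IsCompetitive mu0 mu1 (fun _ => α) (fun _ => β) (fun _ => γ)) :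
    (t : ℝ) ≤ α + β := by
  by_contra! hlt
  obtain ⟨κ, hκ⟩ := exists_guesses_of_isCompetitive hB false
  obtain ⟨n, hn⟩ := exists_lt_mul_add_mul one_pos (sub_pos.mpr hlt) κ
  obtain ⟨y, hy⟩ := hκ n
  have h := hy fun i => !y i
  have hlarge := hn _ _ (sum_toNat_add_sum_toNat_not y)
  have h0 : mu0 n (fun i => !y i) (fun _ => false) = (∑ i, (!y i).toNat : ℕ) := by simp [mu0]
  have h1 : mu1 n (fun i => !y i) (fun _ => false) = 0 := by simp [mu1]
  rw [asgCost_not_left, asgCost_self, h0, h1, NNReal.coe_natCast, NNReal.coe_zero,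
    Nat.cast_add, Nat.cast_mul] at h
  linarith

theorem le_add_sub_one_mul_of_isCompetitive_asg {t : ℕ+} {B : (asg t).Algorithm} {α β γ : ℝ≥0}
    (hB : B.IsCompetitive mu0 mu1 (fun _ => α) (fun _ => β) (fun _ => γ)) :
    (t : ℝ) ≤ α + ((t : ℝ) - 1) * γ := by
  have ht : (1 : ℝ) ≤ t := by exact_mod_cast t.pos
  obtain ⟨κ, hκ⟩ := exists_guesses_of_isCompetitive hB true
  rcases lt_or_ge (γ : ℝ) 1 with hγ | hγ
  · by_contra! hlt
    have hα : (α : ℝ) < t := by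
      have := mul_nonneg (sub_nonneg.mpr ht) γ.coe_nonneg
      linarith
    obtain ⟨n, hn⟩ := exists_lt_mul_add_mul (sub_pos.mpr hγ) (sub_pos.mpr hα) κ
    obtain ⟨y, hy⟩ := hκ n
    have h := hy fun i => !y i
    have hlarge := hn _ _ (sum_toNat_add_sum_toNat_not y)
    have h0 : mu0 n (fun i => !y i) (fun _ => true) = 0 := by simp [mu0]
    have h1 : mu1 n (fun i => !y i) (fun _ => true) = (∑ i, (y i).toNat : ℕ) := by
      rw [mu1]
      congr 1
      refine Finset.sum_congr rfl fun i _ => ?_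
      cases y i <;> rfl
    rw [asgCost_not_left, asgCost_self, h0, h1, NNReal.coe_natCast, NNReal.coe_zero,
      Nat.cast_add, Nat.cast_mul] at h
    linarith
  · have hα : (1 : ℝ) ≤ α := by
      by_contra! hα
      obtain ⟨n, hn⟩ := exists_lt_mul_add_mul (sub_pos.mpr hα) (sub_pos.mpr hα) κ
      obtain ⟨y, hy⟩ := hκ n
      have h := hy fun _ => true
      have hlarge := hn n 0 rfl
      have hcost : (n : ℝ) ≤ asgCost t (fun _ => true) y := by
        exact_mod_cast le_asgCost_true t y
      have h0 : mu0 n (fun _ => true) (fun _ => true) = 0 := by simp [mu0]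
      have h1 : mu1 n (fun _ => true) (fun _ => true) = 0 := by simp [mu1]
      have hopt : asgCost t (fun _ : Fin n => true) (fun _ => true) = n := by
        simp [asgCost_self]
      rw [hopt, h0, h1, NNReal.coe_zero] at h
      rw [Nat.cast_zero] at hlarge
      linarith
    have := mul_le_mul_of_nonneg_left hγ (sub_nonneg.mpr ht)
    linarith

end OnlinePred

theorem mainTheorem3 (t : ℕ+) (P : OnlinePred.Problem.{u, v})
    (hP : OnlinePred.IsHard OnlinePred.mu0 OnlinePred.mu1 t P)
    (α β γ : ℝ≥0) (A : P.Algorithm)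
    (hA : A.IsCompetitive OnlinePred.mu0 OnlinePred.mu1
      (fun _ => α) (fun _ => β) (fun _ => γ)) :
    (t : ℝ) ≤ (α : ℝ) + (β : ℝ) ∧ (t : ℝ) ≤ (α : ℝ) + ((t : ℝ) - 1) * (γ : ℝ) := by
  obtain ⟨B, hB⟩ := hP α β γ ⟨A, hA⟩
  exact ⟨OnlinePred.le_add_of_isCompetitive_asg hB,
    OnlinePred.le_add_sub_one_mul_of_isCompetitive_asg hB⟩
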